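/- Let $d\ge 1$, let $A\in\mathbb{R}^{d\times d}$ be an invertible matrix, let $L=A\mathbb{Z}^d$ be the lattice it generates, and let $L^{\perp}=(A^{T})^{-1}\mathbb{Z}^d$ be the dual lattice. Let $\Omega\subseteq\mathbb{R}^d$ be a fundamental domain of $L$, i.e. a measurable set such that every $x\in\mathbb{R}^d$ can be written in exactly one way as $x=\omega+\lambda$ with $\omega\in\Omega$, $\lambda\in L$. Equip $\Omega$ with the normalised Lebesgue measure $\mathrm{d}x/|\Omega|$. Let $0<\alpha\le 1$ and $1<p\le 2$, and let $f\colon\Omega\to\mathbb{C}$ belong to the additive Hölder–Lipschitz space $\mathrm{Lip}_\Omega(\alpha,p)$, i.e. $f\in L^p(\Omega)$ and \[\|f(\cdot+h)-f\|_{L^p(\Omega)}=O(|h|^{\alpha})\quad\text{as } h\to 0,\] where $f(\cdot+h)$ is formed with the $L$-periodic extension of $f$ to $\mathbb{R}^d$ and $|\cdot|$ is the Euclidean norm. Then the Fourier coefficients \[\widehat f(\kappa)=\frac{1}{|\Omega|}\int_\Omega f(x)\,e^{-2\pi i\kappa\cdot x}\,\mathrm{d}x,\qquad \kappa\in L^{\perp},\]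 satisfy $\widehat f\in\ell^{\gamma}(L^{\perp})$ for every $\gamma$ with \[\frac{p}{p+\frac{\alpha}{d}p-1}<\gamma\le\infty.\] (For $0<\gamma<1$, $\widehat f\in\ell^\gamma(L^\perp)$ means $\sum_{\kappa\in L^\perp}|\widehat f(\kappa)|^\gamma<\infty$.) -/

import Mathlib

open MeasureTheory Filter Topology
open scoped ENNReal NNReal Matrix

noncomputable section

namespace LatticeTitchmarsh

/-- The lattice `A ℤ^d` in `ℝ^d` generated by the columns of the matrix `A`. It is a (full rank)
lattice when `A` is invertible. -/
def lattice {d : ℕ} (A : Matrix (Fin d) (Fin d) ℝ) : AddSubgroup (EuclideanSpace ℝ (Fin d)) where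
  carrier := {x | ∃ n : Fin d → ℤ, x = WithLp.toLp 2 (A *ᵥ fun i => (n i : ℝ))}
  zero_mem' := ⟨0, by ext i; simp [Matrix.mulVec, dotProduct]⟩
  add_mem' := by
    rintro _ _ ⟨m, rfl⟩ ⟨n, rfl⟩
    refine ⟨m + n, ?_⟩
    ext i
    simp [Matrix.mulVec, dotProduct, mul_add, Finset.sum_add_distrib]
  neg_mem' := by
    rintro _ ⟨m, rfl⟩
    refine ⟨-m, ?_⟩
    ext i
    simp [Matrix.mulVec, dotProduct]

/-- The dual lattice `(Aᵀ)⁻¹ ℤ^d` of the lattice `A ℤ^d`. -/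
def dualLattice {d : ℕ} (A : Matrix (Fin d) (Fin d) ℝ) : AddSubgroup (EuclideanSpace ℝ (Fin d)) :=
  lattice (Aᵀ)⁻¹

/-- `Ω` is a fundamental domain of `L`: a (Lebesgue) measurable set such that every point of `ℝ^d`
is the sum of an element of `Ω` and an element of `L` in exactly one way. -/
structure IsFundamentalDomain {d : ℕ} (L : AddSubgroup (EuclideanSpace ℝ (Fin d)))
    (Ω : Set (EuclideanSpace ℝ (Fin d))) : Prop where
  measurable : NullMeasurableSet Ω volume
  directSum : AddSubgroup.IsComplement Ω (L : Set (EuclideanSpace ℝ (Fin d)))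

/-- The normalised Lebesgue measure `dx / |Ω|` on `Ω`. -/
def normalizedMeasure {d : ℕ} (Ω : Set (EuclideanSpace ℝ (Fin d))) :
    Measure (EuclideanSpace ℝ (Fin d)) :=
  (volume Ω)⁻¹ • volume.restrict Ω

/-- The `L`-periodic extension to `ℝ^d` of (the restriction to `Ω` of) `f`: its value at `x` is the
value of `f` at the representative in `Ω` of the coset `x + L`. -/
def periodicExtension {d : ℕ} {L : AddSubgroup (EuclideanSpace ℝ (Fin d))}
    {Ω : Set (EuclideanSpace ℝ (Fin d))} (hΩ : IsFundamentalDomain L Ω)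
    (f : EuclideanSpace ℝ (Fin d) → ℂ) (x : EuclideanSpace ℝ (Fin d)) : ℂ :=
  f ((Equiv.ofBijective _ hΩ.directSum).symm x).1

/-- Membership in the additive Hölder-Lipschitz space `Lip_Ω(α, p)`: `f ∈ L^p(Ω)`, and
`‖f(· + h) - f‖_{L^p(Ω)} = O(|h|^α)` as `h → 0`, where `f(· + h)` is understood through the periodic
extension of `f`. -/
structure MemHolderLipschitz {d : ℕ} {L : AddSubgroup (EuclideanSpace ℝ (Fin d))}
    {Ω : Set (EuclideanSpace ℝ (Fin d))} (hΩ : IsFundamentalDomain L Ω) (α : ℝ) (p : ℝ≥0∞)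
    (f : EuclideanSpace ℝ (Fin d) → ℂ) : Prop where
  memLp : MemLp f p (normalizedMeasure Ω)
  isBigO : ∃ C : ℝ≥0, ∀ᶠ h in 𝓝 (0 : EuclideanSpace ℝ (Fin d)),
    eLpNorm (fun x => periodicExtension hΩ f (x + h) - periodicExtension hΩ f x) p
      (normalizedMeasure Ω) ≤ C * ENNReal.ofReal (‖h‖ ^ α)

/-- The Fourier transform `f̂(κ) = |Ω|⁻¹ ∫_Ω f(x) e^{-2πi κ·x} dx`. -/
def fourierTransform {d : ℕ} (Ω : Set (EuclideanSpace ℝ (Fin d)))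
    (f : EuclideanSpace ℝ (Fin d) → ℂ) (κ : EuclideanSpace ℝ (Fin d)) : ℂ :=
  ((volume.real Ω : ℝ) : ℂ)⁻¹ *
    ∫ x in Ω, f x * Complex.exp (-2 * Real.pi * Complex.I * (inner ℝ κ x : ℝ))

end LatticeTitchmarsh

end

/-! Write `q = p / (p - 1)`. Translating `f` by `h` multiplies its coefficient at `κ` by the
character value `χ_κ(h) = e^{2πi κ·h}`, so the difference `f(· + h) - f` has coefficients `(χ_κ(h) -
1) f̂(κ)`. Let `c` be the integer coordinates of `κ`. For `h = A e_k / (4N)` the phase of `χ_κ(h)`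
is `(π/2) c_k / N`, so `|χ_κ(h) - 1| ≥ 1` on the shell `N ≤ |c_k| < 2N`, while the `L^p` norm of the
difference is `O(N^{-α})`. A Hausdorff-Young bound then limits the number of `κ` in the shell with
`|f̂(κ)| > t` to `O(t^{-q} N^{-αq})` (`exists_shell_card_le`).

Summing over the dyadic shells beyond `N` and counting every point of the remaining cube gives
`O(N^d + t^{-q} N^{-αq})`. The choice `N ≈ t^{-s/d}` with `s = qd / (d + αq)` balances the two
terms, so `f̂` is in weak `ℓ^s` (`exists_card_levelSet_le`). This `s` is the threshold in the
theorem, and a bounded weak `ℓ^s` family lies in `ℓ^γ` for all finite `γ > s`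
(`exists_sum_rpow_le_of_card_levelSet_le`).

Since `γ > s` is strict, the weak-type form of Hausdorff-Young suffices. It follows from truncation
and Bessel's inequality (`weak_hausdorffYoung`), without interpolation. -/

namespace LatticeTitchmarsh

/-! ### Weak-type Hausdorff-Young inequality -/

section WeakHausdorffYoung

variable {X ι : Type*} [MeasurableSpace X] {μ : Measure X}

/-- Bessel's inequality for an orthonormal system of functions in `L²(μ)`. -/
theorem bessel_integral [DecidableEq ι] {e : ι → X → ℂ} (he : ∀ i, MemLp (e i) 2 μ)
    (horth : ∀ i j, ∫ x, (starRingEnd ℂ) (e i x) * e j x ∂μ = if i = j then 1 else 0)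
    {g : X → ℂ} (hg : MemLp g 2 μ) (S : Finset ι) :
    ∑ i ∈ S, ‖∫ x, (starRingEnd ℂ) (e i x) * g x ∂μ‖ ^ 2 ≤ ∫ x, ‖g x‖ ^ 2 ∂μ := by
  have hinner : ∀ {u v : X → ℂ} (hu : MemLp u 2 μ) (hv : MemLp v 2 μ),
      inner ℂ (hu.toLp u) (hv.toLp v) = ∫ x, (starRingEnd ℂ) (u x) * v x ∂μ := by
    intro u v hu hv
    rw [L2.inner_def]
    refine integral_congr_ae ?_
    filter_upwards [hu.coeFn_toLp, hv.coeFn_toLp] with x h1 h2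
    rw [h1, h2, RCLike.inner_apply, mul_comm]
  have hon : Orthonormal ℂ fun i => (he i).toLp (e i) := by
    rw [orthonormal_iff_ite]
    intro i j
    rw [hinner (he i) (he j), horth]
  have h := hon.sum_inner_products_le (s := S) (hg.toLp g)
  have hn : ‖hg.toLp g‖ ^ 2 = ∫ x, ‖g x‖ ^ 2 ∂μ := by
    have h1 := inner_self_eq_norm_sq_to_K (𝕜 := ℂ) (hg.toLp g)
    rw [hinner hg hg] at h1
    have h2 : ∀ x, (starRingEnd ℂ) (g x) * g x = ((‖g x‖ ^ 2 : ℝ) : ℂ) := by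
      intro x
      rw [Complex.conj_mul']
      norm_cast
    simp_rw [h2] at h1
    rw [integral_complex_ofReal] at h1
    exact (Complex.ofReal_injective (by simpa using h1)).symm
  rw [← hn]
  refine le_trans (le_of_eq ?_) h
  refine Finset.sum_congr rfl fun i _ => ?_
  rw [hinner (he i) hg]

/-- Truncation at height `lam` splits the level sets of the coefficients of an `L^p` function. -/
theorem card_levelSet_mul_sq_le [DecidableEq ι] [IsFiniteMeasure μ] {e : ι → X → ℂ}
    (hm : ∀ i, AEStronglyMeasurable (e i) μ) (hb : ∀ i x, ‖e i x‖ ≤ 1)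
    (horth : ∀ i j, ∫ x, (starRingEnd ℂ) (e i x) * e j x ∂μ = if i = j then 1 else 0)
    {p : ℝ} (hp : 1 < p) (hp2 : p ≤ 2) {g : X → ℂ} (hgm : AEStronglyMeasurable g μ)
    (hgi : Integrable (fun x => ‖g x‖ ^ p) μ) {b : ℝ} (hgb : ∫ x, ‖g x‖ ^ p ∂μ ≤ b)
    {lam t : ℝ} (hlam : 0 < lam) (ht : 0 < t) (hlt : lam ^ (1 - p) * b ≤ t / 2) (S : Finset ι)
    (hS : ∀ i ∈ S, t < ‖∫ x, (starRingEnd ℂ) (e i x) * g x ∂μ‖) :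
    S.card * (t / 2) ^ 2 ≤ lam ^ (2 - p) * b := by
  -- A strongly measurable representative makes the truncation set `U` measurable.
  obtain ⟨g', hg'm, hgg'⟩ := hgm
  have hae : (fun x => ‖g x‖ ^ p) =ᵐ[μ] fun x => ‖g' x‖ ^ p := by
    filter_upwards [hgg'] with x hx
    rw [hx]
  rw [integrable_congr hae] at hgi
  rw [integral_congr_ae hae] at hgb
  have hcoef : ∀ i, ∫ x, (starRingEnd ℂ) (e i x) * g x ∂μ
      = ∫ x, (starRingEnd ℂ) (e i x) * g' x ∂μ := fun i => by
    refine integral_congr_ae ?_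
    filter_upwards [hgg'] with x hx
    rw [hx]
  simp_rw [hcoef] at hS
  set U : Set X := {x | ‖g' x‖ ≤ lam} with hU
  have hUm : MeasurableSet U := measurableSet_le hg'm.norm.measurable measurable_const
  set g₂ : X → ℂ := U.indicator g' with hg₂
  set g₁ : X → ℂ := Uᶜ.indicator g' with hg₁
  have hsum : ∀ x, g' x = g₁ x + g₂ x := fun x => by
    by_cases hx : x ∈ U <;> simp [hg₁, hg₂, hx]
  -- The large part is controlled in `L¹` because `1 - p < 0`; the small part `g₂` is controlled in
  -- `L²` because `2 - p ≥ 0`.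
  have hb1 : ∀ x, ‖g₁ x‖ ≤ lam ^ (1 - p) * ‖g' x‖ ^ p := by
    intro x
    by_cases hx : x ∈ U
    · simp only [hg₁, Set.indicator_of_notMem (Set.notMem_compl_iff.2 hx), norm_zero]
      positivity
    · have hx' : lam < ‖g' x‖ := not_le.1 hx
      have h0 : 0 < ‖g' x‖ := hlam.trans hx'
      rw [hg₁, Set.indicator_of_mem (show x ∈ Uᶜ from hx)]
      calc ‖g' x‖ = ‖g' x‖ ^ (1 - p) * ‖g' x‖ ^ p := by
            rw [← Real.rpow_add h0]; simp
        _ ≤ _ := by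
            exact mul_le_mul_of_nonneg_right
              (Real.rpow_le_rpow_of_nonpos hlam hx'.le (by linarith)) (by positivity)
  have hb2 : ∀ x, ‖g₂ x‖ ^ 2 ≤ lam ^ (2 - p) * ‖g' x‖ ^ p := by
    intro x
    by_cases hx : x ∈ U
    · rw [hg₂, Set.indicator_of_mem hx]
      rcases (norm_nonneg (g' x)).eq_or_lt with h0 | h0
      · rw [← h0]
        simp only [ne_eq, OfNat.ofNat_ne_zero, not_false_eq_true, zero_pow]
        positivity
      · calc ‖g' x‖ ^ 2 = ‖g' x‖ ^ (2 - p) * ‖g' x‖ ^ p := by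
              rw [← Real.rpow_add h0]
              simp
          _ ≤ _ := by
              exact mul_le_mul_of_nonneg_right
                (Real.rpow_le_rpow h0.le hx (by linarith)) (by positivity)
    · simp only [hg₂, Set.indicator_of_notMem hx, norm_zero, ne_eq, OfNat.ofNat_ne_zero,
        not_false_eq_true, zero_pow]
      positivity
  have hm1 : AEStronglyMeasurable g₁ μ := (hg'm.indicator hUm.compl).aestronglyMeasurable
  have hm2 : AEStronglyMeasurable g₂ μ := (hg'm.indicator hUm).aestronglyMeasurable
  have hi1 : Integrable g₁ μ :=
    (hgi.const_mul (lam ^ (1 - p))).mono' hm1 (Eventually.of_forall hb1)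
  have hmem2 : MemLp g₂ 2 μ := by
    rw [memLp_two_iff_integrable_sq_norm hm2]
    refine (hgi.const_mul (lam ^ (2 - p))).mono' (hm2.norm.pow 2) (Eventually.of_forall ?_)
    intro x
    rw [Real.norm_of_nonneg (by positivity)]
    exact hb2 x
  have hi2 : Integrable g₂ μ := hmem2.integrable (by norm_num)
  have hconj : ∀ i, AEStronglyMeasurable (fun x => (starRingEnd ℂ) (e i x)) μ := fun i =>
    Complex.continuous_conj.comp_aestronglyMeasurable (hm i)
  have hcb : ∀ i x, ‖(starRingEnd ℂ) (e i x)‖ ≤ 1 := fun i x => by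
    rw [RCLike.norm_conj]; exact hb i x
  have hei : ∀ i {u : X → ℂ}, Integrable u μ →
      Integrable (fun x => (starRingEnd ℂ) (e i x) * u x) μ := fun i u hu =>
    hu.bdd_mul (hconj i) (Eventually.of_forall (hcb i))
  -- The `L¹` part accounts for at most `t / 2` of each coefficient, so the rest must come from the
  -- `L²` part, to which Bessel applies.
  have hlow : ∀ i ∈ S, t / 2 ≤ ‖∫ x, (starRingEnd ℂ) (e i x) * g₂ x ∂μ‖ := by
    intro i hi
    have h1 : ‖∫ x, (starRingEnd ℂ) (e i x) * g₁ x ∂μ‖ ≤ t / 2 := by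
      refine le_trans ?_ hlt
      refine le_trans (norm_integral_le_of_norm_le (hgi.const_mul (lam ^ (1 - p)))
        (Eventually.of_forall fun x => ?_)) ?_
      · rw [norm_mul]
        exact (mul_le_of_le_one_left (norm_nonneg _) (hcb i x)).trans (hb1 x)
      · rw [integral_const_mul]
        gcongr
    have h2 := hS i hi
    simp_rw [hsum, mul_add] at h2
    rw [integral_add (hei i hi1) (hei i hi2)] at h2
    have h3 := norm_add_le (∫ x, (starRingEnd ℂ) (e i x) * g₁ x ∂μ)
      (∫ x, (starRingEnd ℂ) (e i x) * g₂ x ∂μ)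
    linarith
  have hmeme : ∀ i, MemLp (e i) 2 μ := fun i =>
    MemLp.of_bound (hm i) 1 (Eventually.of_forall (hb i))
  calc S.card * (t / 2) ^ 2 = ∑ i ∈ S, (t / 2) ^ 2 := by simp
    _ ≤ ∑ i ∈ S, ‖∫ x, (starRingEnd ℂ) (e i x) * g₂ x ∂μ‖ ^ 2 := by
        refine Finset.sum_le_sum fun i hi => ?_
        have := hlow i hi
        gcongr
    _ ≤ ∫ x, ‖g₂ x‖ ^ 2 ∂μ := bessel_integral hmeme horth hmem2 S
    _ ≤ ∫ x, lam ^ (2 - p) * ‖g' x‖ ^ p ∂μ :=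
        integral_mono_of_nonneg (Eventually.of_forall fun x => by positivity)
          (hgi.const_mul _) (Eventually.of_forall hb2)
    _ ≤ _ := by
        rw [integral_const_mul]
        gcongr

/-- The weak-type Hausdorff-Young inequality for a bounded orthonormal system. -/
theorem weak_hausdorffYoung [DecidableEq ι] [IsFiniteMeasure μ] {e : ι → X → ℂ}
    (hm : ∀ i, AEStronglyMeasurable (e i) μ) (hb : ∀ i x, ‖e i x‖ ≤ 1)
    (horth : ∀ i j, ∫ x, (starRingEnd ℂ) (e i x) * e j x ∂μ = if i = j then 1 else 0)
    {p : ℝ} (hp : 1 < p) (hp2 : p ≤ 2) {g : X → ℂ} (hgm : AEStronglyMeasurable g μ)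
    (hgi : Integrable (fun x => ‖g x‖ ^ p) μ) {B : ℝ} (hB : 0 < B)
    (hgb : ∫ x, ‖g x‖ ^ p ∂μ ≤ B ^ p)
    {t : ℝ} (ht : 0 < t) (S : Finset ι)
    (hS : ∀ i ∈ S, t < ‖∫ x, (starRingEnd ℂ) (e i x) * g x ∂μ‖) :
    (S.card : ℝ) ≤ 4 * 2 ^ ((2 - p) / (p - 1)) * (B / t) ^ (p / (p - 1)) := by
  have hp1 : 0 < p - 1 := by linarith
  set r : ℝ := 1 / (p - 1) with hr
  have hrp : r * (p - 1) = 1 := by rw [hr]; field_simp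
  -- The height for which `lam ^ (1 - p) * B ^ p` is exactly `t / 2`.
  set lam : ℝ := (2 * B ^ p / t) ^ r with hlamdef
  have hbase : 0 < 2 * B ^ p / t := by positivity
  have hlam : 0 < lam := by positivity
  have h1 : lam ^ (1 - p) = (2 * B ^ p / t)⁻¹ := by
    rw [hlamdef, ← Real.rpow_mul hbase.le, show r * (1 - p) = -1 by linarith, Real.rpow_neg_one]
  have hlt : lam ^ (1 - p) * B ^ p ≤ t / 2 := by
    rw [h1]
    have : B ^ p ≠ 0 := by positivity
    apply le_of_eq
    field_simp
  have key := card_levelSet_mul_sq_le hm hb horth hp hp2 hgm hgi hgb hlam ht hlt S hS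
  have h2 : lam ^ (2 - p) = 2 ^ (r * (2 - p)) * (B ^ (p * (r * (2 - p))) / t ^ (r * (2 - p))) := by
    rw [hlamdef, ← Real.rpow_mul hbase.le, Real.div_rpow (by positivity) ht.le,
      Real.mul_rpow (by norm_num) (by positivity), ← Real.rpow_mul hB.le, mul_div_assoc]
  have e1 : r * (2 - p) = (2 - p) / (p - 1) := by rw [hr]; ring
  have e2 : p / (p - 1) = p * (r * (2 - p)) + p := by
    rw [e1]; field_simp; ring
  have e3 : p / (p - 1) = r * (2 - p) + 2 := by
    rw [e1]; field_simp; ring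
  have h3 : (B / t) ^ (p / (p - 1))
      = B ^ (p * (r * (2 - p))) * B ^ p / (t ^ (r * (2 - p)) * t ^ 2) := by
    rw [Real.div_rpow hB.le ht.le]
    congr 1
    · rw [e2, Real.rpow_add hB]
    · rw [e3, Real.rpow_add ht, Real.rpow_two]
  rw [h3, ← e1]
  rw [h2] at key
  have ht2 : 0 < (t / 2) ^ 2 := by positivity
  rw [← le_div_iff₀ ht2] at key
  refine key.trans (le_of_eq ?_)
  have : t ^ (r * (2 - p)) ≠ 0 := by positivity
  field_simp
  ring

end WeakHausdorffYoung

end LatticeTitchmarsh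

namespace LatticeTitchmarsh

/-! ### Level sets, dyadic shells and weak `ℓ^s` -/

section Counting

variable {ι : Type*}

/-- A bounded family in weak `ℓ^s` belongs to `ℓ^r` for all `r > s`. -/
theorem exists_sum_rpow_le_of_card_levelSet_le {a : ι → ℝ} (ha : ∀ i, 0 ≤ a i) {M C s r : ℝ}
    (haM : ∀ i, a i ≤ M) (hs : 0 < s) (hsr : s < r)
    (hC : ∀ t, 0 < t → t < M → ∀ S : Finset ι, (∀ i ∈ S, t < a i) → (S.card : ℝ) ≤ C * t ^ (-s)) :
    ∃ D : ℝ, ∀ S : Finset ι, ∑ i ∈ S, a i ^ r ≤ D := by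
  have hr : 0 < r := hs.trans hsr
  -- The layer-cake integral: level sets are empty above `M`, and `r - s - 1 > -1` gives convergence
  -- at `0`.
  set I : ℝ≥0∞ := ENNReal.ofReal r *
    ∫⁻ t in Set.Ioo 0 M, ENNReal.ofReal (C * t ^ (r - s - 1)) with hI
  have hIfin : I ≠ ∞ := by
    refine ENNReal.mul_ne_top ENNReal.ofReal_ne_top ?_
    rcases le_or_gt M 0 with hM | hM
    · simp [Set.Ioo_eq_empty_of_le hM]
    have hint : IntegrableOn (fun t : ℝ => C * t ^ (r - s - 1)) (Set.Ioo 0 M) := by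
      have := (intervalIntegral.intervalIntegrable_rpow' (a := 0) (b := M)
        (show -1 < r - s - 1 by linarith))
      rw [intervalIntegrable_iff_integrableOn_Ioo_of_le hM.le] at this
      exact this.const_mul C
    exact hint.lintegral_lt_top.ne
  refine ⟨I.toReal, fun S => ?_⟩
  let _ : MeasurableSpace S := ⊤
  have hcake := lintegral_rpow_eq_lintegral_meas_lt_mul (Measure.count : Measure S)
    (f := fun i => a i) (Eventually.of_forall fun i => ha i) (measurable_from_top.aemeasurable) hr
  rw [lintegral_count, tsum_fintype] at hcake
  have hle : ∑ i : S, ENNReal.ofReal (a i ^ r) ≤ I := by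
    rw [hcake, hI]
    gcongr ENNReal.ofReal r * ?_
    rw [← lintegral_indicator measurableSet_Ioi, ← lintegral_indicator measurableSet_Ioo]
    refine lintegral_mono fun t => ?_
    by_cases ht : 0 < t
    · rw [Set.indicator_of_mem (show t ∈ Set.Ioi 0 from ht)]
      by_cases htM : t < M
      · rw [Set.indicator_of_mem (show t ∈ Set.Ioo 0 M from ⟨ht, htM⟩)]
        rw [Measure.count_apply_finite _ (Set.toFinite _)]
        have h1 := hC t ht htM (((Set.toFinite {i : S | t < a i}).toFinset).map
          (Function.Embedding.subtype _)) (by simpa using fun i hi _ => hi)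
        rw [Finset.card_map] at h1
        rw [← ENNReal.ofReal_natCast, ← ENNReal.ofReal_mul (by positivity)]
        refine ENNReal.ofReal_le_ofReal ?_
        calc _ ≤ C * t ^ (-s) * t ^ (r - 1) := by gcongr
          _ = C * t ^ (r - s - 1) := by
              rw [mul_assoc, ← Real.rpow_add ht]
              ring_nf
      · have : {i : S | t < a i} = ∅ := by
          ext i
          simpa using (haM i).trans (not_lt.1 htM)
        simp [this]
    · rw [Set.indicator_of_notMem (show t ∉ Set.Ioi 0 from ht)]
      exact zero_le
  rw [Finset.sum_coe_sort S fun i => ENNReal.ofReal (a i ^ r),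
    ← ENNReal.ofReal_sum_of_nonneg fun i _ => Real.rpow_nonneg (ha i) r] at hle
  have h2 := ENNReal.toReal_mono hIfin hle
  rwa [ENNReal.toReal_ofReal (Finset.sum_nonneg fun i _ => Real.rpow_nonneg (ha i) r)] at h2

/-- Counting over dyadic shells of `ℤ^d`: a bound for the number of indices in each shell yields a
bound for the number of all indices. -/
theorem card_le_of_card_shell_le {d : ℕ} {c : ι → Fin d → ℤ} (hc : Function.Injective c)
    {Q β : ℝ} (hQ : 0 ≤ Q) (hβ : 0 < β) {N₀ : ℕ} (hN₀ : 1 ≤ N₀) (S : Finset ι)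
    (hS : ∀ N : ℕ, N₀ ≤ N → ∀ k : Fin d, ∀ T ⊆ S,
      (∀ i ∈ T, N ≤ (c i k).natAbs ∧ (c i k).natAbs < 2 * N) →
        (T.card : ℝ) ≤ Q * (N : ℝ) ^ (-β)) :
    (S.card : ℝ) ≤ (2 * N₀ : ℝ) ^ d + d * Q * (1 - 2 ^ (-β))⁻¹ * (N₀ : ℝ) ^ (-β) := by
  classical
  -- A crude bound on the dyadic exponents that occur, since `log₂ m ≤ m`; the final estimate does
  -- not depend on it.
  set J : ℕ := S.sup (fun i => Finset.univ.sup fun k => (c i k).natAbs) + 1 with hJ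
  set S₀ : Finset ι := S.filter fun i => ∀ k, (c i k).natAbs < N₀ with hS₀
  set T : ℕ → Fin d → Finset ι := fun j k =>
    S.filter fun i => 2 ^ j * N₀ ≤ (c i k).natAbs ∧ (c i k).natAbs < 2 * (2 ^ j * N₀) with hT
  have hcover : S ⊆ S₀ ∪ (Finset.range J).biUnion fun j => Finset.univ.biUnion fun k => T j k := by
    intro i hi
    by_cases h : ∀ k, (c i k).natAbs < N₀
    · exact Finset.mem_union_left _ (Finset.mem_filter.2 ⟨hi, h⟩)
    · push Not at h
      obtain ⟨k, hk⟩ := h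
      refine Finset.mem_union_right _ ?_
      have hne : (c i k).natAbs / N₀ ≠ 0 := by
        have := Nat.div_pos hk (by omega)
        omega
      refine Finset.mem_biUnion.2 ⟨Nat.log 2 ((c i k).natAbs / N₀), ?_, ?_⟩
      · have h1 : Nat.log 2 ((c i k).natAbs / N₀) ≤ (c i k).natAbs :=
          (Nat.log_le_self _ _).trans (Nat.div_le_self _ _)
        have h2 : (c i k).natAbs ≤ Finset.univ.sup fun k => (c i k).natAbs :=
          Finset.le_sup (f := fun k => (c i k).natAbs) (Finset.mem_univ k)
        have h3 : (Finset.univ.sup fun k => (c i k).natAbs) ≤ _ :=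
          Finset.le_sup (f := fun i => Finset.univ.sup fun k => (c i k).natAbs) hi
        rw [Finset.mem_range]
        omega
      · refine Finset.mem_biUnion.2 ⟨k, Finset.mem_univ _, Finset.mem_filter.2 ⟨hi, ?_, ?_⟩⟩
        · exact (Nat.le_div_iff_mul_le (by omega)).1 (Nat.pow_log_le_self 2 hne)
        · have h1 := Nat.lt_pow_succ_log_self (b := 2) (by norm_num) ((c i k).natAbs / N₀)
          rw [Nat.div_lt_iff_lt_mul (by omega)] at h1
          rw [pow_succ] at h1
          calc _ < _ := h1
            _ = _ := by ring
  have hcard₀ : (S₀.card : ℝ) ≤ (2 * N₀ : ℝ) ^ d := by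
    have h1 : S₀.card ≤ (Fintype.piFinset fun _ : Fin d => Finset.Ico (-(N₀ : ℤ)) N₀).card := by
      refine Finset.card_le_card_of_injOn c ?_ hc.injOn
      intro i hi
      have hi' := (Finset.mem_filter.1 hi).2
      simp only [Finset.mem_coe, Fintype.mem_piFinset, Finset.mem_Ico]
      intro k
      have := hi' k
      omega
    have h2 : (Fintype.piFinset fun _ : Fin d => Finset.Ico (-(N₀ : ℤ)) N₀).card
        = (2 * N₀) ^ d := by
      simp only [Fintype.card_piFinset, Int.card_Ico, Finset.prod_const, Finset.card_univ,
        Fintype.card_fin]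
      congr 1
      omega
    rw [h2] at h1
    exact_mod_cast h1
  have hx0 : (0 : ℝ) ≤ 2 ^ (-β) := by positivity
  have hx1 : (2 : ℝ) ^ (-β) < 1 := Real.rpow_lt_one_of_one_lt_of_neg (by norm_num) (by linarith)
  have hcardT : ∀ j k, ((T j k).card : ℝ) ≤ Q * (N₀ : ℝ) ^ (-β) * ((2 : ℝ) ^ (-β)) ^ j := by
    intro j k
    have h := hS (2 ^ j * N₀) (Nat.le_mul_of_pos_left _ (by positivity)) k (T j k)
      (Finset.filter_subset _ _) fun i hi => (Finset.mem_filter.1 hi).2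
    refine h.trans (le_of_eq ?_)
    push_cast
    rw [Real.mul_rpow (by positivity) (by positivity), ← Real.rpow_natCast, ← Real.rpow_natCast,
      ← Real.rpow_mul (by norm_num), ← Real.rpow_mul (by norm_num), mul_comm (j : ℝ) (-β)]
    ring
  have hgeom : ∑ j ∈ Finset.range J, ((2 : ℝ) ^ (-β)) ^ j ≤ (1 - 2 ^ (-β))⁻¹ := by
    rw [← tsum_geometric_of_lt_one hx0 hx1]
    exact (summable_geometric_of_lt_one hx0 hx1).sum_le_tsum _ fun j _ => by positivity
  have hnat : S.card ≤ S₀.card + ∑ j ∈ Finset.range J, ∑ k, (T j k).card :=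
    (Finset.card_le_card hcover).trans <| (Finset.card_union_le _ _).trans <|
      Nat.add_le_add_left (Finset.card_biUnion_le.trans <|
        Finset.sum_le_sum fun j _ => Finset.card_biUnion_le) _
  calc (S.card : ℝ) ≤ S₀.card + ∑ j ∈ Finset.range J, ∑ k, ((T j k).card : ℝ) := by
        exact_mod_cast hnat
    _ ≤ (2 * N₀ : ℝ) ^ d + ∑ j ∈ Finset.range J, ∑ k : Fin d,
          Q * (N₀ : ℝ) ^ (-β) * ((2 : ℝ) ^ (-β)) ^ j := by
        gcongr with j _ k _
        exact hcardT j k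
    _ = (2 * N₀ : ℝ) ^ d + d * (Q * (N₀ : ℝ) ^ (-β)) *
          ∑ j ∈ Finset.range J, ((2 : ℝ) ^ (-β)) ^ j := by
        simp only [Finset.sum_const, Finset.card_univ, Fintype.card_fin, nsmul_eq_mul]
        rw [Finset.mul_sum]
        congr 1
        exact Finset.sum_congr rfl fun j _ => by ring
    _ ≤ (2 * N₀ : ℝ) ^ d + d * (Q * (N₀ : ℝ) ^ (-β)) * (1 - 2 ^ (-β))⁻¹ := by gcongr
    _ = _ := by ring

/-- Shell bounds `K t^{-q} N^{-β}` for the level sets of a bounded family indexed by lattice points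
of `ℤ^d` imply that the family is in weak `ℓ^s`, where `s = qd / (d + β)`. -/
theorem exists_card_levelSet_le {d : ℕ} (hd : 1 ≤ d) {c : ι → Fin d → ℤ}
    (hc : Function.Injective c) {a : ι → ℝ} {K q β : ℝ} (hK : 0 ≤ K) (hq : 0 < q) (hβ : 0 < β)
    {N₀ : ℕ} (hN₀ : 1 ≤ N₀)
    (hS : ∀ t : ℝ, 0 < t → ∀ N : ℕ, N₀ ≤ N → ∀ k : Fin d, ∀ T : Finset ι,
      (∀ i ∈ T, t < a i) → (∀ i ∈ T, N ≤ (c i k).natAbs ∧ (c i k).natAbs < 2 * N) →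
        (T.card : ℝ) ≤ K * t ^ (-q) * (N : ℝ) ^ (-β)) (M : ℝ) :
    ∃ C : ℝ, ∀ t, 0 < t → t < M → ∀ S : Finset ι, (∀ i ∈ S, t < a i) →
      (S.card : ℝ) ≤ C * t ^ (-(q * d / (d + β))) := by
  set s : ℝ := q * d / (d + β) with hs
  have hd0 : (0 : ℝ) < d := by exact_mod_cast hd
  have hs0 : 0 < s := by positivity
  -- The factor `M ^ (s / d)` absorbs the rounding and the offset `N₀` in the cutoff `N` below: `t <
  -- M` gives `1 ≤ M ^ (s / d) * y`.
  refine ⟨(2 * (1 + (1 + N₀) * M ^ (s / d))) ^ d + d * K * (1 - 2 ^ (-β))⁻¹, ?_⟩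
  intro t ht htM S hSt
  have hM : 0 < M := ht.trans htM
  have hx1 : (2 : ℝ) ^ (-β) < 1 := Real.rpow_lt_one_of_one_lt_of_neg (by norm_num) (by linarith)
  -- The balancing cutoff: `y ^ d` and `t ^ (-q) * y ^ (-β)` both equal `t ^ (-s)`.
  set y : ℝ := t ^ (-(s / d)) with hy
  have hy0 : 0 < y := by positivity
  set N : ℕ := ⌈y⌉₊ + N₀ with hN
  have hN0 : N₀ ≤ N := by omega
  have hNy : y ≤ N := by
    rw [hN]; push_cast
    exact (Nat.le_ceil y).trans (by simp)
  have hNle : (N : ℝ) ≤ (1 + (1 + N₀) * M ^ (s / d)) * y := by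
    have h1 : (⌈y⌉₊ : ℝ) ≤ y + 1 := (Nat.ceil_lt_add_one hy0.le).le
    have h2 : 1 ≤ M ^ (s / d) * y := by
      rw [hy, Real.rpow_neg ht.le, ← div_eq_mul_inv, one_le_div (by positivity)]
      gcongr
    rw [hN]; push_cast
    have h3 : (1 + N₀ : ℝ) * 1 ≤ (1 + N₀) * (M ^ (s / d) * y) := by gcongr
    nlinarith
  have hcard := card_le_of_card_shell_le hc (Q := K * t ^ (-q)) (by positivity) hβ
    (hN₀.trans hN0) S fun N' hN' k T hT hTN => hS t ht N' (hN0.trans hN') k T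
      (fun i hi => hSt i (hT hi)) hTN
  have hyd : y ^ d = t ^ (-s) := by
    rw [hy, ← Real.rpow_natCast, ← Real.rpow_mul ht.le]
    congr 1
    field_simp
  have hyβ : t ^ (-q) * y ^ (-β) = t ^ (-s) := by
    rw [hy, ← Real.rpow_mul ht.le, ← Real.rpow_add ht]
    congr 1
    rw [hs]
    field_simp
    ring
  have hinv : 0 ≤ (1 - (2 : ℝ) ^ (-β))⁻¹ := inv_nonneg.2 (by linarith)
  calc (S.card : ℝ) ≤ (2 * N : ℝ) ^ d + d * (K * t ^ (-q)) * (1 - 2 ^ (-β))⁻¹ * (N : ℝ) ^ (-β) :=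
        hcard
    _ ≤ (2 * ((1 + (1 + N₀) * M ^ (s / d)) * y)) ^ d
        + d * (K * t ^ (-q)) * (1 - 2 ^ (-β))⁻¹ * y ^ (-β) := by
        gcongr ?_ + _ * ?_
        · gcongr
        · exact Real.rpow_le_rpow_of_nonpos hy0 hNy (by linarith)
    _ = (2 * (1 + (1 + N₀) * M ^ (s / d))) ^ d * y ^ d
        + d * K * (1 - 2 ^ (-β))⁻¹ * (t ^ (-q) * y ^ (-β)) := by
        rw [← mul_pow]; ring
    _ = _ := by rw [hyd, hyβ]; ring

end Counting

end LatticeTitchmarsh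

namespace LatticeTitchmarsh

/-! ### Periodic functions and translation of fundamental domains -/

section FundamentalDomain

open scoped Pointwise

variable {d : ℕ} {L : AddSubgroup (EuclideanSpace ℝ (Fin d))}
  {Ω : Set (EuclideanSpace ℝ (Fin d))}

theorem IsFundamentalDomain.isAddFundamentalDomain (hΩ : IsFundamentalDomain L Ω) :
    IsAddFundamentalDomain L Ω volume := by
  refine IsAddFundamentalDomain.mk' hΩ.measurable fun x => ?_
  obtain ⟨⟨ω, l⟩, h, huniq⟩ := hΩ.directSum.existsUnique x
  have h' : (ω : EuclideanSpace ℝ (Fin d)) + l = x := h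
  refine ⟨-⟨l, l.2⟩, ?_, ?_⟩
  · have : (-⟨l, l.2⟩ : L) +ᵥ x = ω := by
      rw [AddSubgroup.vadd_def, vadd_eq_add, ← h']
      simp
    simp only [this, Subtype.coe_prop]
  · intro g hg
    have := huniq ⟨⟨g +ᵥ x, hg⟩, ⟨-g, L.neg_mem g.2⟩⟩ (by
      simp [AddSubgroup.vadd_def])
    have h2 : (-g : EuclideanSpace ℝ (Fin d)) = l := 
      congrArg (fun y => (y.2 : EuclideanSpace ℝ (Fin d))) this
    ext1
    simp [← h2]

theorem periodicExtension_vadd (hΩ : IsFundamentalDomain L Ω)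
    (f : EuclideanSpace ℝ (Fin d) → ℂ) (g : L) (x : EuclideanSpace ℝ (Fin d)) :
    periodicExtension hΩ f (g +ᵥ x) = periodicExtension hΩ f x := by
  unfold periodicExtension
  set E := Equiv.ofBijective _ hΩ.directSum with hE
  have h1 : E ⟨(E.symm x).1, ⟨(E.symm x).2 + g, L.add_mem (E.symm x).2.2 g.2⟩⟩ = g +ᵥ x := by
    have h2 : ((E.symm x).1 : EuclideanSpace ℝ (Fin d)) + (E.symm x).2 = x :=
      E.apply_symm_apply x
    calc _ = ((E.symm x).1 : EuclideanSpace ℝ (Fin d)) + ((E.symm x).2 + g) := rfl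
      _ = g + (((E.symm x).1 : EuclideanSpace ℝ (Fin d)) + (E.symm x).2) := by abel
      _ = _ := by rw [h2]; rfl
  rw [← h1, E.symm_apply_apply]

theorem periodicExtension_eq_of_mem (hΩ : IsFundamentalDomain L Ω)
    (f : EuclideanSpace ℝ (Fin d) → ℂ) {x : EuclideanSpace ℝ (Fin d)} (hx : x ∈ Ω) :
    periodicExtension hΩ f x = f x := by
  unfold periodicExtension
  set E := Equiv.ofBijective _ hΩ.directSum with hE
  have h1 : E ⟨⟨x, hx⟩, ⟨0, L.zero_mem⟩⟩ = x := by simp [hE]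
  nth_rewrite 1 [← h1]
  rw [E.symm_apply_apply]

theorem IsFundamentalDomain.vadd_isAddFundamentalDomain (hΩ : IsFundamentalDomain L Ω)
    (h : EuclideanSpace ℝ (Fin d)) : IsAddFundamentalDomain L (h +ᵥ Ω) volume := by
  have : VAddCommClass (EuclideanSpace ℝ (Fin d)) L (EuclideanSpace ℝ (Fin d)) :=
    ⟨fun a g x => by simp only [AddSubgroup.vadd_def, vadd_eq_add]; abel⟩
  exact hΩ.isAddFundamentalDomain.vadd_of_comm h

/-- The translate `h +ᵥ Ω` is again a fundamental domain, and a periodic function has the same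
integral over any two of them. -/
theorem setIntegral_comp_add_right (hΩ : IsFundamentalDomain L Ω) [Countable L]
    {φ : EuclideanSpace ℝ (Fin d) → ℂ} (hφ : ∀ (g : L) x, φ (g +ᵥ x) = φ x)
    (h : EuclideanSpace ℝ (Fin d)) : ∫ x in Ω, φ (x + h) = ∫ x in Ω, φ x := by
  rw [hΩ.isAddFundamentalDomain.setIntegral_eq (hΩ.vadd_isAddFundamentalDomain h) hφ]
  have hpre : (fun x => x + h) ⁻¹' (h +ᵥ Ω) = Ω := by
    ext x
    simp [Set.mem_vadd_set_iff_neg_vadd_mem]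
  have hemb := (measurePreserving_add_right volume h).setIntegral_preimage_emb
    (measurableEmbedding_addRight h) φ (h +ᵥ Ω)
  rw [← hemb, hpre]

theorem aestronglyMeasurable_comp_add_right (hΩ : IsFundamentalDomain L Ω) [Countable L]
    {φ : EuclideanSpace ℝ (Fin d) → ℂ} (hφ : ∀ (g : L) x, φ (g +ᵥ x) = φ x)
    (hm : AEStronglyMeasurable φ (volume.restrict Ω)) (h : EuclideanSpace ℝ (Fin d)) :
    AEStronglyMeasurable (fun x => φ (x + h)) (volume.restrict Ω) := by
  rw [hΩ.isAddFundamentalDomain.aestronglyMeasurable_on_iff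
    (hΩ.vadd_isAddFundamentalDomain h) hφ] at hm
  have hpre : (fun x => x + h) ⁻¹' (h +ᵥ Ω) = Ω := by
    ext x
    simp [Set.mem_vadd_set_iff_neg_vadd_mem]
  have hmp := (measurePreserving_add_right volume h).restrict_preimage_emb
    (measurableEmbedding_addRight h) (h +ᵥ Ω)
  rw [hpre] at hmp
  exact hm.comp_measurePreserving hmp

theorem IsFundamentalDomain.volume_ne_zero (hΩ : IsFundamentalDomain L Ω) [Countable L] :
    volume Ω ≠ 0 :=
  hΩ.isAddFundamentalDomain.measure_ne_zero (NeZero.ne _)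

end FundamentalDomain

/-! ### The dual lattice and its characters -/

section Lattice

open scoped Pointwise

variable {d : ℕ} {A : Matrix (Fin d) (Fin d) ℝ} {Ω : Set (EuclideanSpace ℝ (Fin d))}

instance countable_lattice : Countable (lattice A) := by
  have : Function.Surjective fun n : Fin d → ℤ =>
      (⟨WithLp.toLp 2 (A *ᵥ fun i => (n i : ℝ)), n, rfl⟩ : lattice A) := by
    rintro ⟨_, n, rfl⟩
    exact ⟨n, rfl⟩
  exact this.countable

/-- Lattice translates of the compact parallelepiped `A [0,1]^d` cover the space, so its volume
bounds that of `Ω`. Covering alone is needed, so overlapping faces do no harm. -/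
theorem IsFundamentalDomain.volume_ne_top (hA : IsUnit A.det)
    (hΩ : IsFundamentalDomain (lattice A) Ω) : volume Ω ≠ ∞ := by
  set P : Set (EuclideanSpace ℝ (Fin d)) :=
    (fun y : Fin d → ℝ => WithLp.toLp 2 (A *ᵥ y)) '' Set.Icc 0 1 with hP
  have hcont : Continuous fun y : Fin d → ℝ => WithLp.toLp 2 (A *ᵥ y) := by fun_prop
  have hPc : IsCompact P := isCompact_Icc.image hcont
  have hcov : ∀ x, ∃ g : lattice A, x ∈ g +ᵥ P := by
    intro x
    set y := A⁻¹ *ᵥ (WithLp.ofLp x) with hy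
    refine ⟨⟨WithLp.toLp 2 (A *ᵥ fun i => ((⌊y i⌋ : ℤ) : ℝ)), _, rfl⟩, ?_⟩
    refine ⟨WithLp.toLp 2 (A *ᵥ fun i => Int.fract (y i)), ⟨_, ⟨fun i => Int.fract_nonneg _,
      fun i => (Int.fract_lt_one _).le⟩, rfl⟩, ?_⟩
    simp only [AddSubgroup.vadd_def, vadd_eq_add]
    rw [← WithLp.toLp_add, ← Matrix.mulVec_add]
    have : ((fun i => ((⌊y i⌋ : ℤ) : ℝ)) + fun i => Int.fract (y i)) = y := by
      ext i
      exact Int.floor_add_fract _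
    rw [this, hy, Matrix.mulVec_mulVec, Matrix.mul_nonsing_inv _ hA, Matrix.one_mulVec]
  have hle : volume Ω ≤ volume P := by
    calc volume Ω ≤ volume (⋃ g : lattice A, (g +ᵥ P) ∩ Ω) :=
          measure_mono fun x hx => by
            obtain ⟨g, hg⟩ := hcov x
            exact Set.mem_iUnion.2 ⟨g, hg, hx⟩
      _ ≤ ∑' g : lattice A, volume ((g +ᵥ P) ∩ Ω) := measure_iUnion_le _
      _ = volume P := (hΩ.isAddFundamentalDomain.measure_eq_tsum P).symm
  exact (hle.trans_lt hPc.measure_lt_top).ne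

/-- Integer coordinates of the points of the dual lattice. -/
theorem exists_dualLattice_coord (hA : IsUnit A.det) :
    ∃ c : dualLattice A → Fin d → ℤ, Function.Injective c ∧ ∀ (κ : dualLattice A) (y : Fin d → ℝ),
      inner ℝ (κ : EuclideanSpace ℝ (Fin d)) (WithLp.toLp 2 (A *ᵥ y)) = ∑ i, (c κ i : ℝ) * y i := by
  choose c hc using fun κ : dualLattice A => κ.2
  refine ⟨c, fun κ κ' h => Subtype.ext ?_, fun κ y => ?_⟩
  · rw [hc κ, hc κ', h]
  · rw [hc κ, EuclideanSpace.inner_toLp_toLp, star_trivial, dotProduct_comm,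
      ← Matrix.transpose_nonsing_inv, Matrix.mulVec_transpose, ← Matrix.dotProduct_mulVec,
      Matrix.mulVec_mulVec, Matrix.nonsing_inv_mul _ hA, Matrix.one_mulVec]
    rfl

/-- The character `x ↦ e^{2πi κ·x}`. -/
noncomputable def latticeChar (κ x : EuclideanSpace ℝ (Fin d)) : ℂ :=
  Complex.exp (2 * Real.pi * Complex.I * (inner ℝ κ x : ℝ))

theorem latticeChar_eq_exp_ofReal_mul_I (κ x : EuclideanSpace ℝ (Fin d)) :
    latticeChar κ x = Complex.exp ((2 * Real.pi * inner ℝ κ x : ℝ) * Complex.I) := by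
  unfold latticeChar
  congr 1
  push_cast
  ring

theorem norm_latticeChar (κ x : EuclideanSpace ℝ (Fin d)) : ‖latticeChar κ x‖ = 1 := by
  rw [latticeChar_eq_exp_ofReal_mul_I, Complex.norm_exp_ofReal_mul_I]

theorem continuous_latticeChar (κ : EuclideanSpace ℝ (Fin d)) : Continuous (latticeChar κ) := by
  unfold latticeChar
  fun_prop

theorem latticeChar_add_right (κ x y : EuclideanSpace ℝ (Fin d)) :
    latticeChar κ (x + y) = latticeChar κ x * latticeChar κ y := by
  unfold latticeChar
  rw [← Complex.exp_add, inner_add_right]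
  congr 1
  push_cast
  ring

theorem conj_latticeChar (κ x : EuclideanSpace ℝ (Fin d)) :
    (starRingEnd ℂ) (latticeChar κ x) =
      Complex.exp (-2 * Real.pi * Complex.I * (inner ℝ κ x : ℝ)) := by
  unfold latticeChar
  rw [← Complex.exp_conj]
  congr 1
  simp [Complex.conj_ofNat]

theorem conj_latticeChar_mul (κ κ' x : EuclideanSpace ℝ (Fin d)) :
    (starRingEnd ℂ) (latticeChar κ x) * latticeChar κ' x = latticeChar (κ' - κ) x := by
  rw [conj_latticeChar]
  unfold latticeChar
  rw [← Complex.exp_add, inner_sub_left]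
  congr 1
  push_cast
  ring

theorem conj_latticeChar_mul_self (κ x : EuclideanSpace ℝ (Fin d)) :
    (starRingEnd ℂ) (latticeChar κ x) * latticeChar κ x = 1 := by
  rw [conj_latticeChar_mul]
  simp [latticeChar]

theorem latticeChar_lattice (hA : IsUnit A.det) (κ : dualLattice A) (g : lattice A) :
    latticeChar (κ : EuclideanSpace ℝ (Fin d)) g = 1 := by
  obtain ⟨c, -, hc⟩ := exists_dualLattice_coord hA
  obtain ⟨_, n, rfl⟩ := g
  unfold latticeChar
  rw [hc, Complex.exp_eq_one_iff]
  refine ⟨∑ i, c κ i * n i, ?_⟩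
  push_cast
  ring

theorem latticeChar_vadd (hA : IsUnit A.det) (κ : dualLattice A) (g : lattice A)
    (x : EuclideanSpace ℝ (Fin d)) :
    latticeChar (κ : EuclideanSpace ℝ (Fin d)) (g +ᵥ x) = latticeChar κ x := by
  rw [AddSubgroup.vadd_def, vadd_eq_add, latticeChar_add_right, latticeChar_lattice hA, one_mul]

theorem integral_normalizedMeasure (φ : EuclideanSpace ℝ (Fin d) → ℂ) :
    ∫ x, φ x ∂(normalizedMeasure Ω) = ((volume.real Ω : ℝ) : ℂ)⁻¹ * ∫ x in Ω, φ x := by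
  unfold normalizedMeasure
  rw [integral_smul_measure, ENNReal.toReal_inv, Complex.real_smul, Complex.ofReal_inv]
  rfl

theorem isProbabilityMeasure_normalizedMeasure (hA : IsUnit A.det)
    (hΩ : IsFundamentalDomain (lattice A) Ω) : IsProbabilityMeasure (normalizedMeasure Ω) := by
  constructor
  unfold normalizedMeasure
  rw [Measure.smul_apply, Measure.restrict_apply_univ, smul_eq_mul,
    ENNReal.inv_mul_cancel hΩ.volume_ne_zero (hΩ.volume_ne_top hA)]

theorem integral_conj_latticeChar_mul (hA : IsUnit A.det)
    (hΩ : IsFundamentalDomain (lattice A) Ω) (κ κ' : dualLattice A) [Decidable (κ = κ')] :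
    ∫ x, (starRingEnd ℂ) (latticeChar (κ : EuclideanSpace ℝ (Fin d)) x) *
      latticeChar (κ' : EuclideanSpace ℝ (Fin d)) x ∂(normalizedMeasure Ω)
        = if κ = κ' then 1 else 0 := by
  have := isProbabilityMeasure_normalizedMeasure hA hΩ
  split_ifs with h
  · subst h
    simp_rw [conj_latticeChar_mul_self]
    simp
  · set ξ : dualLattice A := κ' - κ with hξ
    have hξ0 : ξ ≠ 0 := sub_ne_zero.2 (Ne.symm h)
    have hcoe : ((κ' : EuclideanSpace ℝ (Fin d)) - κ) = ξ := rfl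
    simp_rw [conj_latticeChar_mul, hcoe]
    rw [integral_normalizedMeasure]
    have hξ0' : (ξ : EuclideanSpace ℝ (Fin d)) ≠ 0 := by simpa using hξ0
    have hn : inner ℝ (ξ : EuclideanSpace ℝ (Fin d)) (ξ : EuclideanSpace ℝ (Fin d)) ≠ 0 :=
      inner_self_ne_zero.2 hξ0'
    -- Chosen so that `ξ·v = 1/2`: translation by `v` flips the sign of the character but preserves
    -- its integral over `Ω`, which must therefore vanish.
    set v : EuclideanSpace ℝ (Fin d) :=
      (2 * inner ℝ (ξ : EuclideanSpace ℝ (Fin d)) (ξ : EuclideanSpace ℝ (Fin d)))⁻¹ • (ξ : _)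
      with hv
    have hchar : latticeChar (ξ : EuclideanSpace ℝ (Fin d)) v = -1 := by
      rw [latticeChar_eq_exp_ofReal_mul_I, hv, inner_smul_right]
      have : 2 * Real.pi * ((2 * inner ℝ (ξ : EuclideanSpace ℝ (Fin d))
          (ξ : EuclideanSpace ℝ (Fin d)))⁻¹ * inner ℝ (ξ : EuclideanSpace ℝ (Fin d))
          (ξ : EuclideanSpace ℝ (Fin d))) = Real.pi := by
        field_simp
      rw [this, Complex.exp_pi_mul_I]
    have h1 := setIntegral_comp_add_right hΩ (latticeChar_vadd hA ξ) v
    simp_rw [latticeChar_add_right, hchar] at h1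
    rw [integral_mul_const] at h1
    have h2 : ∫ x in Ω, latticeChar (ξ : EuclideanSpace ℝ (Fin d)) x = 0 := by
      linear_combination (-1 / 2 : ℂ) * h1
    rw [h2, mul_zero]

theorem ae_mem_normalizedMeasure {L : AddSubgroup (EuclideanSpace ℝ (Fin d))}
    (hΩ : IsFundamentalDomain L Ω) : ∀ᵐ x ∂(volume.restrict Ω), x ∈ Ω :=
  ae_restrict_mem₀ hΩ.measurable

theorem fourierTransform_eq_integral (hΩ : IsFundamentalDomain (lattice A) Ω)
    (f : EuclideanSpace ℝ (Fin d) → ℂ) (κ : EuclideanSpace ℝ (Fin d)) :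
    fourierTransform Ω f κ = ∫ x, (starRingEnd ℂ) (latticeChar κ x) *
      periodicExtension hΩ f x ∂(normalizedMeasure Ω) := by
  rw [integral_normalizedMeasure]
  unfold fourierTransform
  congr 1
  refine integral_congr_ae ?_
  filter_upwards [ae_mem_normalizedMeasure hΩ] with x hx
  rw [periodicExtension_eq_of_mem hΩ f hx, conj_latticeChar, mul_comm]

/-- Shift the periodic integrand by `h` and use that the character is multiplicative and unimodular.
-/
theorem integral_conj_latticeChar_mul_translate (hA : IsUnit A.det)
    (hΩ : IsFundamentalDomain (lattice A) Ω) (f : EuclideanSpace ℝ (Fin d) → ℂ)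
    (κ : dualLattice A) (h : EuclideanSpace ℝ (Fin d)) :
    ∫ x, (starRingEnd ℂ) (latticeChar (κ : EuclideanSpace ℝ (Fin d)) x) *
      periodicExtension hΩ f (x + h) ∂(normalizedMeasure Ω)
        = latticeChar κ h * fourierTransform Ω f κ := by
  have hper : ∀ (g : lattice A) x,
      (starRingEnd ℂ) (latticeChar (κ : EuclideanSpace ℝ (Fin d)) (g +ᵥ x)) *
        periodicExtension hΩ f (g +ᵥ x) =
      (starRingEnd ℂ) (latticeChar (κ : EuclideanSpace ℝ (Fin d)) x) *
        periodicExtension hΩ f x := fun g x => by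
    rw [latticeChar_vadd hA, periodicExtension_vadd]
  have h1 := setIntegral_comp_add_right hΩ
    (φ := fun x => (starRingEnd ℂ) (latticeChar (κ : EuclideanSpace ℝ (Fin d)) x) *
        periodicExtension hΩ f x) hper h
  rw [fourierTransform_eq_integral hΩ, integral_normalizedMeasure, integral_normalizedMeasure, ← h1,
    mul_left_comm, ← integral_const_mul (latticeChar (κ : EuclideanSpace ℝ (Fin d)) h)]
  congr 1
  refine integral_congr_ae (Eventually.of_forall fun x => ?_)
  beta_reduce
  rw [latticeChar_add_right, map_mul]
  linear_combination (-(starRingEnd ℂ) (latticeChar (κ : EuclideanSpace ℝ (Fin d)) x) *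
    periodicExtension hΩ f (x + h)) * conj_latticeChar_mul_self (κ : EuclideanSpace ℝ (Fin d)) h

end Lattice

end LatticeTitchmarsh

namespace LatticeTitchmarsh

/-! ### From Hölder-Lipschitz regularity to shell bounds -/

section HolderLipschitz

variable {d : ℕ} {A : Matrix (Fin d) (Fin d) ℝ} {Ω : Set (EuclideanSpace ℝ (Fin d))}
  {f : EuclideanSpace ℝ (Fin d) → ℂ}

theorem normalizedMeasure_absolutelyContinuous :
    normalizedMeasure Ω ≪ volume.restrict Ω :=
  Measure.smul_absolutelyContinuous

theorem restrict_absolutelyContinuous_normalizedMeasure (hA : IsUnit A.det)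
    (hΩ : IsFundamentalDomain (lattice A) Ω) : volume.restrict Ω ≪ normalizedMeasure Ω :=
  Measure.absolutelyContinuous_smul (ENNReal.inv_ne_zero.2 (hΩ.volume_ne_top hA))

theorem memLp_periodicExtension {p : ℝ≥0∞} (hΩ : IsFundamentalDomain (lattice A) Ω)
    (hf : MemLp f p (normalizedMeasure Ω)) :
    MemLp (periodicExtension hΩ f) p (normalizedMeasure Ω) := by
  refine hf.ae_eq ?_
  refine normalizedMeasure_absolutelyContinuous.ae_le ?_
  filter_upwards [ae_mem_normalizedMeasure hΩ] with x hx
  rw [periodicExtension_eq_of_mem hΩ f hx]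

theorem aestronglyMeasurable_periodicExtension_add (hA : IsUnit A.det)
    (hΩ : IsFundamentalDomain (lattice A) Ω)
    (hf : AEStronglyMeasurable (periodicExtension hΩ f) (normalizedMeasure Ω))
    (h : EuclideanSpace ℝ (Fin d)) :
    AEStronglyMeasurable (fun x => periodicExtension hΩ f (x + h)) (normalizedMeasure Ω) :=
  (aestronglyMeasurable_comp_add_right hΩ (periodicExtension_vadd hΩ f)
    (hf.mono_ac (restrict_absolutelyContinuous_normalizedMeasure hA hΩ)) h).mono_ac
      normalizedMeasure_absolutelyContinuous

theorem integrable_conj_latticeChar_mul {g : EuclideanSpace ℝ (Fin d) → ℂ}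
    {μ : Measure (EuclideanSpace ℝ (Fin d))} (hg : Integrable g μ)
    (κ : EuclideanSpace ℝ (Fin d)) :
    Integrable (fun x => (starRingEnd ℂ) (latticeChar κ x) * g x) μ :=
  hg.bdd_mul (c := 1)
    (Complex.continuous_conj.comp (continuous_latticeChar κ)).aestronglyMeasurable
    (Eventually.of_forall fun x => by rw [RCLike.norm_conj, norm_latticeChar])

theorem one_le_norm_exp_sub_one {x : ℝ} (h1 : Real.pi / 2 ≤ |x|) (h2 : |x| ≤ Real.pi) :
    1 ≤ ‖Complex.exp (x * Complex.I) - 1‖ := by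
  have hcos : Real.cos x ≤ 0 := by
    rw [← Real.cos_abs]
    exact Real.cos_nonpos_of_pi_div_two_le_of_le h1 (by linarith [Real.pi_pos])
  have hre : (Complex.exp (x * Complex.I) - 1).re = Real.cos x - 1 := by
    rw [Complex.sub_re, Complex.exp_ofReal_mul_I_re, Complex.one_re]
  have := Complex.abs_re_le_norm (Complex.exp (x * Complex.I) - 1)
  rw [hre, abs_of_nonpos (by linarith)] at this
  linarith

/-- The coefficients of a difference `f(· + h) - f` whose `L^p` norm is at most `B`. -/
theorem card_le_of_eLpNorm_translate_sub_le (hA : IsUnit A.det)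
    (hΩ : IsFundamentalDomain (lattice A) Ω) {p : ℝ} (hp : 1 < p) (hp2 : p ≤ 2)
    (hf : MemLp f (ENNReal.ofReal p) (normalizedMeasure Ω)) {h : EuclideanSpace ℝ (Fin d)}
    {B : ℝ} (hB : 0 < B)
    (hfB : eLpNorm (fun x => periodicExtension hΩ f (x + h) - periodicExtension hΩ f x)
      (ENNReal.ofReal p) (normalizedMeasure Ω) ≤ ENNReal.ofReal B)
    {t : ℝ} (ht : 0 < t) (T : Finset (dualLattice A))
    (hT : ∀ κ ∈ T, t < ‖fourierTransform Ω f (κ : EuclideanSpace ℝ (Fin d))‖)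
    (hTh : ∀ κ ∈ T, 1 ≤ ‖latticeChar (κ : EuclideanSpace ℝ (Fin d)) h - 1‖) :
    (T.card : ℝ) ≤ 4 * 2 ^ ((2 - p) / (p - 1)) * (B / t) ^ (p / (p - 1)) := by
  classical
  have hprob := isProbabilityMeasure_normalizedMeasure hA hΩ
  have hF := memLp_periodicExtension hΩ hf
  have hp0 : 0 < p := by linarith
  have hp1 : 1 ≤ ENNReal.ofReal p := ENNReal.one_le_ofReal.2 hp.le
  have hpt : (ENNReal.ofReal p).toReal = p := ENNReal.toReal_ofReal hp0.le
  set F := periodicExtension hΩ f with hFdef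
  set G : EuclideanSpace ℝ (Fin d) → ℂ := fun x => F (x + h) - F x with hG
  have hGmem : MemLp G (ENNReal.ofReal p) (normalizedMeasure Ω) :=
    ⟨(aestronglyMeasurable_periodicExtension_add hA hΩ hF.1 h).sub hF.1,
      hfB.trans_lt ENNReal.ofReal_lt_top⟩
  have hGi : Integrable (fun x => ‖G x‖ ^ p) (normalizedMeasure Ω) := by
    have := hGmem.integrable_norm_rpow (by positivity) ENNReal.ofReal_ne_top
    rwa [hpt] at this
  have hGB : ∫ x, ‖G x‖ ^ p ∂(normalizedMeasure Ω) ≤ B ^ p := by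
    rw [hGmem.eLpNorm_eq_integral_rpow_norm (by positivity) ENNReal.ofReal_ne_top, hpt,
      ENNReal.ofReal_le_ofReal_iff hB.le] at hfB
    exact (Real.rpow_inv_le_iff_of_pos
      (integral_nonneg fun x => Real.rpow_nonneg (norm_nonneg _) _) hB.le hp0).1 hfB
  refine weak_hausdorffYoung
    (e := fun (κ : dualLattice A) x => latticeChar (κ : EuclideanSpace ℝ (Fin d)) x)
    (fun κ => (continuous_latticeChar _).aestronglyMeasurable)
    (fun κ x => (norm_latticeChar _ _).le)
    (fun κ κ' => integral_conj_latticeChar_mul hA hΩ κ κ') hp hp2 hGmem.1 hGi hB hGB ht T ?_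
  intro κ hκ
  have hcoef : ∫ x, (starRingEnd ℂ) (latticeChar (κ : EuclideanSpace ℝ (Fin d)) x) * G x
      ∂(normalizedMeasure Ω) =
        (latticeChar (κ : EuclideanSpace ℝ (Fin d)) h - 1) * fourierTransform Ω f κ := by
    -- Expanding `F(· + h) = G + F` uses only the integrability of `G` and `F`, so none is needed
    -- for the translate.
    have h1 := integral_add
      (integrable_conj_latticeChar_mul (hGmem.integrable hp1) (κ : EuclideanSpace ℝ (Fin d)))
      (integrable_conj_latticeChar_mul (hF.integrable hp1) (κ : EuclideanSpace ℝ (Fin d)))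
    simp_rw [← mul_add, hG, sub_add_cancel] at h1
    rw [hFdef, integral_conj_latticeChar_mul_translate hA hΩ f κ h,
      ← fourierTransform_eq_integral hΩ] at h1
    rw [hG, hFdef]
    linear_combination -h1
  rw [hcoef, norm_mul]
  exact (hT κ hκ).trans_le (le_mul_of_one_le_left (norm_nonneg _) (hTh κ hκ))

/-- The phase has absolute value `(π/2) |m| / N`, which lies between `π/2` and `π`, so the character
value has nonpositive real part. -/
theorem one_le_norm_latticeChar_sub_one {κ h : EuclideanSpace ℝ (Fin d)} {m : ℤ} {N : ℕ}
    (hκ : inner ℝ κ h = m * (1 / (4 * N) : ℝ)) (hN : 1 ≤ N) (h1 : N ≤ m.natAbs)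
    (h2 : m.natAbs < 2 * N) : 1 ≤ ‖latticeChar κ h - 1‖ := by
  have hN0 : (0 : ℝ) < N := by exact_mod_cast hN
  have habs : (m.natAbs : ℝ) = |(m : ℝ)| := by
    rw [Nat.cast_natAbs, Int.cast_abs]
  have h1' : (N : ℝ) ≤ |(m : ℝ)| := by rw [← habs]; exact_mod_cast h1
  have h2' : |(m : ℝ)| ≤ 2 * N := by rw [← habs]; exact_mod_cast h2.le
  have hx : |2 * Real.pi * inner ℝ κ h| = Real.pi / 2 * (|(m : ℝ)| / N) := by
    rw [hκ, abs_mul (2 * Real.pi), abs_mul (m : ℝ), abs_of_pos (by positivity : 0 < 2 * Real.pi),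
      abs_of_pos (by positivity : (0 : ℝ) < 1 / (4 * N))]
    field_simp
    ring
  have hpi := Real.pi_pos
  rw [latticeChar_eq_exp_ofReal_mul_I]
  apply one_le_norm_exp_sub_one
  · rw [hx]
    exact le_mul_of_one_le_right (by positivity) ((one_le_div hN0).2 h1')
  · rw [hx]
    have : |(m : ℝ)| / N ≤ 2 := (div_le_iff₀ hN0).2 h2'
    nlinarith

theorem exists_shell_card_le (hA : IsUnit A.det) (hΩ : IsFundamentalDomain (lattice A) Ω)
    {α p : ℝ} (hα : 0 < α) (hp : 1 < p) (hp2 : p ≤ 2)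
    (hf : MemHolderLipschitz hΩ α (ENNReal.ofReal p) f) {c : dualLattice A → Fin d → ℤ}
    (hc : ∀ (κ : dualLattice A) (y : Fin d → ℝ),
      inner ℝ (κ : EuclideanSpace ℝ (Fin d)) (WithLp.toLp 2 (A *ᵥ y)) = ∑ i, (c κ i : ℝ) * y i) :
    ∃ K : ℝ, 0 ≤ K ∧ ∃ N₀ : ℕ, 1 ≤ N₀ ∧
      ∀ t : ℝ, 0 < t → ∀ N : ℕ, N₀ ≤ N → ∀ k : Fin d, ∀ T : Finset (dualLattice A),
      (∀ κ ∈ T, t < ‖fourierTransform Ω f (κ : EuclideanSpace ℝ (Fin d))‖) →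
      (∀ κ ∈ T, N ≤ (c κ k).natAbs ∧ (c κ k).natAbs < 2 * N) →
        (T.card : ℝ) ≤ K * t ^ (-(p / (p - 1))) * (N : ℝ) ^ (-(α * (p / (p - 1)))) := by
  obtain ⟨C, hC⟩ := hf.isBigO
  obtain ⟨δ, hδ, hCδ⟩ := Metric.eventually_nhds_iff.1 hC
  set v : Fin d → EuclideanSpace ℝ (Fin d) := fun k => WithLp.toLp 2 (A *ᵥ Pi.single k 1) with hv
  -- One bound for all the directions `A e_k`; the added `1` gives positivity at once.
  set D : ℝ := 1 + ∑ k, ‖v k‖ with hD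
  have hvD : ∀ k, ‖v k‖ ≤ D := fun k => by
    have := Finset.single_le_sum (f := fun k => ‖v k‖) (fun k _ => norm_nonneg _)
      (Finset.mem_univ k)
    linarith
  have hD0 : 0 < D := by positivity
  set q : ℝ := p / (p - 1) with hq
  set W : ℝ := 4 * 2 ^ ((2 - p) / (p - 1)) with hW
  have hC1 : (0 : ℝ) < C + 1 := by positivity
  -- `C + 1` keeps the bound `B` below positive even if `C = 0`. The `+ 1` in the threshold makes `D
  -- / N < δ` strict, so that `h` falls in the ball where the Lipschitz estimate holds.
  refine ⟨W * ((C + 1) * D ^ α) ^ q, by positivity, ⌈D / δ⌉₊ + 1, by omega, ?_⟩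
  intro t ht N hN k T hT hTN
  have hN1 : 1 ≤ N := by omega
  have hN0 : (0 : ℝ) < N := by exact_mod_cast hN1
  have hDN : D / N < δ := by
    have h1 : D / δ < N := (Nat.le_ceil _).trans_lt (by exact_mod_cast hN)
    rw [div_lt_iff₀ hδ] at h1
    rw [div_lt_iff₀ hN0]
    linarith
  set y : Fin d → ℝ := Pi.single k (1 / (4 * N) : ℝ) with hy
  set h : EuclideanSpace ℝ (Fin d) := WithLp.toLp 2 (A *ᵥ y) with hh
  have hhv : h = (1 / (4 * N) : ℝ) • v k := by
    have : y = (1 / (4 * N) : ℝ) • Pi.single k (1 : ℝ) := by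
      rw [hy, ← Pi.single_smul, smul_eq_mul, mul_one]
    rw [hh, this, Matrix.mulVec_smul, WithLp.toLp_smul]
  have hnorm : ‖h‖ ≤ D / N := by
    rw [hhv, norm_smul, Real.norm_of_nonneg (by positivity), div_mul_eq_mul_div, one_mul]
    have := hvD k
    gcongr
    linarith
  have hinner : ∀ κ : dualLattice A, inner ℝ (κ : EuclideanSpace ℝ (Fin d)) h
      = (c κ k : ℝ) * (1 / (4 * N) : ℝ) := by
    intro κ
    rw [hh, hc, hy, Finset.sum_eq_single k]
    · rw [Pi.single_eq_same]
    · intro i _ hi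
      rw [Pi.single_eq_of_ne hi, mul_zero]
    · simp
  set B : ℝ := (C + 1) * (D / N) ^ α with hB
  have hB0 : 0 < B := by positivity
  have hle := hCδ (y := h) (by rw [dist_zero_right]; exact hnorm.trans_lt hDN)
  have hle' : (C : ℝ≥0∞) * ENNReal.ofReal (‖h‖ ^ α) ≤ ENNReal.ofReal B := by
    rw [← ENNReal.ofReal_coe_nnreal, ← ENNReal.ofReal_mul (by positivity)]
    refine ENNReal.ofReal_le_ofReal ?_
    rw [hB]
    gcongr
    linarith
  have hcard := card_le_of_eLpNorm_translate_sub_le hA hΩ hp hp2 hf.memLp hB0 (hle.trans hle') ht T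
    hT fun κ hκ => one_le_norm_latticeChar_sub_one (hinner κ) hN1 (hTN κ hκ).1 (hTN κ hκ).2
  refine hcard.trans (le_of_eq ?_)
  rw [← hW, ← hq]
  have h1 : B / t = (C + 1) * D ^ α * t⁻¹ * ((N : ℝ) ^ α)⁻¹ := by
    rw [hB, Real.div_rpow hD0.le hN0.le]
    ring
  rw [h1, Real.mul_rpow (by positivity) (by positivity), Real.mul_rpow (by positivity)
    (by positivity), Real.inv_rpow ht.le, Real.inv_rpow (by positivity), ← Real.rpow_mul hN0.le,
    Real.rpow_neg ht.le, Real.rpow_neg hN0.le]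
  ring

theorem exists_norm_fourierTransform_le (hA : IsUnit A.det)
    (hΩ : IsFundamentalDomain (lattice A) Ω) {p : ℝ≥0∞} (hp : 1 ≤ p)
    (hf : MemLp f p (normalizedMeasure Ω)) :
    ∃ M : ℝ, ∀ κ : EuclideanSpace ℝ (Fin d), ‖fourierTransform Ω f κ‖ ≤ M := by
  have hprob := isProbabilityMeasure_normalizedMeasure hA hΩ
  refine ⟨∫ x, ‖periodicExtension hΩ f x‖ ∂(normalizedMeasure Ω), fun κ => ?_⟩
  rw [fourierTransform_eq_integral hΩ]
  refine norm_integral_le_of_norm_le ((memLp_periodicExtension hΩ hf).integrable hp).norm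
    (Eventually.of_forall fun x => ?_)
  rw [norm_mul, RCLike.norm_conj, norm_latticeChar, one_mul]

end HolderLipschitz

end LatticeTitchmarsh

/-! ### Summability of the Fourier coefficients -/

theorem mainTheorem1 (d : ℕ) (hd : 1 ≤ d) (A : Matrix (Fin d) (Fin d) ℝ) (hA : IsUnit A.det)
    (Ω : Set (EuclideanSpace ℝ (Fin d)))
    (hΩ : LatticeTitchmarsh.IsFundamentalDomain (LatticeTitchmarsh.lattice A) Ω)
    (α p : ℝ) (hα : 0 < α) (hα1 : α ≤ 1) (hp : 1 < p) (hp2 : p ≤ 2)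
    (f : EuclideanSpace ℝ (Fin d) → ℂ)
    (hf : LatticeTitchmarsh.MemHolderLipschitz hΩ α (ENNReal.ofReal p) f)
    (γ : ℝ≥0∞) (hγ : ENNReal.ofReal (p / (p + α / d * p - 1)) < γ) :
    Memℓp (E := fun _ => ℂ)
      (fun κ : LatticeTitchmarsh.dualLattice A =>
        LatticeTitchmarsh.fourierTransform Ω f (κ : EuclideanSpace ℝ (Fin d))) γ := by
  obtain ⟨M, hM⟩ := LatticeTitchmarsh.exists_norm_fourierTransform_le hA hΩ
    (ENNReal.one_le_ofReal.2 hp.le) hf.memLp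
  rcases eq_or_ne γ ∞ with rfl | hγtop
  · refine memℓp_infty ⟨M, ?_⟩
    rintro _ ⟨κ, rfl⟩
    exact hM κ
  have hp1 : 0 < p - 1 := by linarith
  have hd0 : (0 : ℝ) < d := by exact_mod_cast hd
  -- The weak exponent `qd / (d + β)` with `q = p / (p - 1)` and `β = αq` is the stated threshold.
  have hs : p / (p - 1) * d / (d + α * (p / (p - 1))) = p / (p + α / d * p - 1) := by
    have h1 : 0 < p + α / d * p - 1 := by
      have : 0 < α / d * p := by positivity
      linarith
    have h2 : 0 < d + α * (p / (p - 1)) := by positivity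
    rw [div_eq_div_iff h2.ne' h1.ne']
    field_simp
    ring
  have hs0 : 0 < p / (p - 1) * d / (d + α * (p / (p - 1))) := by positivity
  rw [← hs] at hγ
  have hsγ := (ENNReal.ofReal_lt_iff_lt_toReal hs0.le hγtop).1 hγ
  obtain ⟨c, hcinj, hc⟩ := LatticeTitchmarsh.exists_dualLattice_coord hA
  obtain ⟨K, hK, N₀, hN₀, hshell⟩ :=
    LatticeTitchmarsh.exists_shell_card_le hA hΩ hα hp hp2 hf hc
  obtain ⟨C, hC⟩ := LatticeTitchmarsh.exists_card_levelSet_le hd hcinj hK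
    (show 0 < p / (p - 1) by positivity) (show 0 < α * (p / (p - 1)) by positivity) hN₀ hshell M
  obtain ⟨R, hR⟩ := LatticeTitchmarsh.exists_sum_rpow_le_of_card_levelSet_le
    (a := fun κ : LatticeTitchmarsh.dualLattice A =>
      ‖LatticeTitchmarsh.fourierTransform Ω f (κ : EuclideanSpace ℝ (Fin d))‖)
    (fun κ => norm_nonneg _) (fun κ => hM κ) hs0 hsγ hC
  exact memℓp_gen' hR
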